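/- Conventions. For a real $2\times 2$ matrix $M$ let $\mathbb{T}_M=\mathbb{R}^2/M\mathbb{Z}^2$ (a flat torus when $M$ is nonsingular), and let $\mathbb{T}_\square=\mathbb{T}_I$; the linear map $M$ induces a map $\mathbb{T}_\square\to\mathbb{T}_M$. Graphs $G=(V,E)$ are finite, may have loops and parallel edges, and each edge has a reference orientation. A drawing of $G$ on $\mathbb{T}_M$ is a continuous map from $G$ to $\mathbb{T}_M$; it is geodesic with (native) displacement matrix $D\in\mathbb{R}^{2\times E}$ if each edge $e$ is the projection of a line segment with displacement vector $D_e$. An embedding is an injective drawing all of whose faces (components of the complement of the image) are open disks. The dual graph $G^*$ of an embedding of $G$ on $\mathbb{T}_\square$ has a natural embedding on $\mathbb{T}_\square$: each face of $G$ contains exactly one vertex of $G^*$, each dual edge $e^*$ crosses only $e$, exactly once, from right to left, and each face of $G^*$ contains exactly one vertex of $G$. An equilibrium stress is a vector $\omega\in\mathbb{R}^E$ (of arbitrary signs) such that, at every vertex $p$, $\sum_d \omega_d D_d=0$, the sum running over the darts $d$ (oriented edges) with tail $p$, where reversing a dart negates its displacement. Let $J=\begin{pmatrix}0&-1\\1&0\end{pmatrix}$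 be the counterclockwise quarter turn. Lemma. Let $M$ be a nonsingular real $2\times2$ matrix and let $G$ be a geodesic drawing on $\mathbb{T}_M$ with native displacement matrix $M\Delta$ (so $\Delta$ is the displacement matrix of its image on $\mathbb{T}_\square$ under $M^{-1}$). Suppose that the drawing is homotopic to an embedding, that is, to the image under $M$ of an embedding $G_0$ on $\mathbb{T}_\square$, and let $G^*$ be the dual graph of $G_0$, with its natural embedding. Let $\omega$ be a (not necessarily positive) equilibrium stress for $G$, and let $\Omega=\operatorname{diag}(\omega)$. Then the orthogonal force diagram of $G$ with respect to $\omega$ lies on $\mathbb{T}_N$, where $$N = J M\,\Delta\Omega\Delta^T J^T .$$ That is, there is a geodesic drawing $H$ of $G^*$ on $\mathbb{T}_N$, homotopic to the image under $N$ of the natural embedding of $G^*$ on $\mathbb{T}_\square$, such that for every edge $e$ the displacement vector of $e^*$ is $\omega_e J M\Delta_e$; so $e^*$ is orthogonal to $e$ and has signed length $\omega_e$ times the length of $e$. -/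

import Mathlib

open Set Filter Topology Matrix

/-! ### Graphs and drawings -/

/-- A graph with vertex set `V` and edge set `E`; loops and parallel edges are allowed.
Every edge carries an arbitrary reference orientation, from `tail e` to `head e`; the two darts of
`e` are `e` in this orientation and its reversal. -/
structure Multigraph (V E : Type*) where
  tail : E → V
  head : E → V

/-- A drawing of `G` on a space `X`: a continuous map from `G`, as a topological space
(a one-dimensional cell complex), to `X`. -/
structure Drawing {V E : Type*} (G : Multigraph V E) (X : Type*) [TopologicalSpace X] where
  vert : V → X
  edge : E → C(unitInterval, X)
  edge_zero : ∀ e, edge e 0 = vert (G.tail e)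
  edge_one : ∀ e, edge e 1 = vert (G.head e)

namespace Drawing

variable {V E X Y : Type*} [TopologicalSpace X] [TopologicalSpace Y] {G : Multigraph V E}

/-- The image of a drawing under a continuous map. -/
def map (D : Drawing G X) (f : C(X, Y)) : Drawing G Y where
  vert v := f (D.vert v)
  edge e := f.comp (D.edge e)
  edge_zero e := congrArg f (D.edge_zero e)
  edge_one e := congrArg f (D.edge_one e)

/-- Two drawings of `G` on `X` are homotopic: one can be continuously deformed into the other
through drawings of `G`. -/
def Homotopic (D D' : Drawing G X) : Prop :=
  ∃ F : unitInterval → Drawing G X, F 0 = D ∧ F 1 = D' ∧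
    (∀ v, Continuous fun u => (F u).vert v) ∧
    (∀ e, Continuous fun q : unitInterval × unitInterval => (F q.1).edge e q.2)

/-- The set of points covered by a drawing. -/
def image (D : Drawing G X) : Set X :=
  range D.vert ∪ ⋃ e, range (D.edge e)

/-- The faces of a drawing: the components of the complement of its image. -/
def IsFace (D : Drawing G X) (f : Set X) : Prop :=
  ∃ x ∈ D.imageᶜ, f = connectedComponentIn D.imageᶜ x

/-- A (cellular) embedding: an injective drawing all of whose faces are open disks. -/
structure IsEmbedding (D : Drawing G X) : Prop where
  vert_injective : Function.Injective D.vert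
  edge_ne_vert : ∀ e, ∀ t ∈ Ioo (0 : unitInterval) 1, ∀ v, D.edge e t ≠ D.vert v
  edge_injective : ∀ e e', ∀ t ∈ Ioo (0 : unitInterval) 1, ∀ t' ∈ Ioo (0 : unitInterval) 1,
    D.edge e t = D.edge e' t' → e = e' ∧ t = t'
  cellular : ∀ f, D.IsFace f →
    Nonempty (f ≃ₜ Metric.ball (0 : EuclideanSpace ℝ (Fin 2)) 1)

end Drawing

/-! ### Flat tori -/

/-- The group of translations of the plane generated by the columns of `M`. -/
def latticeOf (M : Matrix (Fin 2) (Fin 2) ℝ) : AddSubgroup (Fin 2 → ℝ) where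
  carrier := {v | ∃ a : Fin 2 → ℤ, v = M *ᵥ fun i => (a i : ℝ)}
  zero_mem' := ⟨0, by ext i; simp [Matrix.mulVec, dotProduct]⟩
  add_mem' := by
    rintro _ _ ⟨a, rfl⟩ ⟨b, rfl⟩
    refine ⟨a + b, ?_⟩
    rw [← Matrix.mulVec_add]
    congr 1
    ext i
    simp
  neg_mem' := by
    rintro _ ⟨a, rfl⟩
    refine ⟨-a, ?_⟩
    rw [← Matrix.mulVec_neg]
    congr 1
    ext i
    simp

/-- The flat torus with shape matrix `M`: the quotient of the plane by the translations generated
by the columns of `M`. It is a torus precisely when `M` is nonsingular. The square flat torus is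
`FlatTorus 1`. -/
abbrev FlatTorus (M : Matrix (Fin 2) (Fin 2) ℝ) : Type :=
  (Fin 2 → ℝ) ⧸ latticeOf M

/-- The covering projection from the plane. -/
def FlatTorus.proj (M : Matrix (Fin 2) (Fin 2) ℝ) (x : Fin 2 → ℝ) : FlatTorus M :=
  QuotientAddGroup.mk x

/-- The map `x ↦ M x` from the square flat torus to the flat torus with shape matrix `M`. The
image on the square torus of a drawing on `FlatTorus M`, for `M` nonsingular, is its preimage
under this homeomorphism. -/
def FlatTorus.ofSquare (M : Matrix (Fin 2) (Fin 2) ℝ) : C(FlatTorus 1, FlatTorus M) where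
  toFun := QuotientAddGroup.map (latticeOf 1) (latticeOf M) M.mulVecLin.toAddMonoidHom (by
    rintro _ ⟨a, rfl⟩
    exact ⟨a, by simp⟩)
  continuous_toFun := by
    refine continuous_quot_lift _ ?_
    exact continuous_quot_mk.comp (M.mulVecLin.continuous_of_finiteDimensional)

/-- A drawing on `FlatTorus M` is geodesic, with displacement matrix `D`: every edge `e` is the
projection of a line segment with displacement vector the column of `D` indexed by `e`. These are
the native displacement vectors, measured in the plane that covers `FlatTorus M`. -/
def Drawing.IsGeodesicWith {V E : Type*} {G : Multigraph V E} {M : Matrix (Fin 2) (Fin 2) ℝ}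
    (Γ : Drawing G (FlatTorus M)) (D : Matrix (Fin 2) E ℝ) : Prop :=
  ∀ e, ∃ x : Fin 2 → ℝ, ∀ t : unitInterval,
    Γ.edge e t = FlatTorus.proj M (x + (t : ℝ) • fun i => D i e)

/-! ### Equilibrium stresses -/

open Classical in
/-- `ω` is an equilibrium stress for a geodesic drawing of `G` with displacement matrix `D`: at
every vertex `p` the vectors `ω d • D d`, over all darts `d` with tail `p`, sum to zero. Such a
dart is either an edge with tail `p`, or the reversal of an edge with head `p`, whose displacement
is negated. -/
def IsEquilibriumStress {V E : Type*} [Fintype E] (G : Multigraph V E)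
    (D : Matrix (Fin 2) E ℝ) (ω : E → ℝ) : Prop :=
  ∀ p : V, (∑ e with G.tail e = p, ω e • fun i => D i e)
    + (∑ e with G.head e = p, ω e • -fun i => D i e) = 0

/-! ### Crossings and duality -/

/-- The closed curve `γ`, parametrized by `[0, 1]`, has winding number `n` around the origin. -/
def HasWindingNumber (γ : ℝ → ℂ) (n : ℤ) : Prop :=
  ∃ L : ℝ → ℂ, ContinuousOn L (Icc 0 1) ∧ (∀ u ∈ Icc (0 : ℝ) 1, Complex.exp (L u) = γ u) ∧
    L 1 - L 0 = n * (2 * Real.pi * Complex.I)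

/-- The point of the complex plane with coordinates `x`. -/
def planePoint (x : Fin 2 → ℝ) : ℂ := ⟨x 0, x 1⟩

/-- The path `d` meets the path `c` exactly once, at interior points `c s₀ = d t₀` of both, and
crosses it there from the right of `c` to the left of `c`, that is, with local intersection number
`+1`. In terms of lifts `c'` and `d'` to the plane with `c' s₀ = d' t₀`: the map
`(x, y) ↦ c' (s₀ + x) - d' (t₀ - y)` has local degree `+1` at its zero `(0, 0)`. (If `c'` and `d'`
are differentiable and transverse there, its derivative is `(x, y) ↦ x • v + y • w` with `v`, `w`
the velocities of `c'`, `d'`, and the condition says that `det (v, w) > 0`.) -/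
def CrossesRightToLeft (c d : C(unitInterval, FlatTorus 1)) : Prop :=
  ∃ s₀ ∈ Ioo (0 : unitInterval) 1, ∃ t₀ ∈ Ioo (0 : unitInterval) 1,
    (∀ s t, c s = d t ↔ s = s₀ ∧ t = t₀) ∧
    ∃ c' d' : ℝ → Fin 2 → ℝ, Continuous c' ∧ Continuous d' ∧
      (∀ s : unitInterval, FlatTorus.proj 1 (c' s) = c s) ∧
      (∀ t : unitInterval, FlatTorus.proj 1 (d' t) = d t) ∧
      c' s₀ = d' t₀ ∧
      ∀ᶠ r in 𝓝[>] (0 : ℝ), HasWindingNumber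
        (fun u => planePoint (c' (s₀ + r * Real.cos (2 * Real.pi * u))
          - d' (t₀ - r * Real.sin (2 * Real.pi * u)))) 1

/-- Let `Γ` be an embedding of `G` on the square flat torus. The graph `G'`, whose edges are
indexed by the edges of `G`, is the dual graph of `Γ`, and `K` is its natural embedding: every
face of `Γ` contains exactly one vertex of `K`, and these are all its vertices; the dual of an edge
`e` crosses only `e`, once, from right to left (so that it leads from the face to the right of `e`
to the face to the left of `e`); and every face of `K` contains exactly one vertex of `Γ`. -/
structure IsNaturalDual {V E F : Type*} {G : Multigraph V E} {G' : Multigraph F E}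
    (Γ : Drawing G (FlatTorus 1)) (K : Drawing G' (FlatTorus 1)) : Prop where
  isEmbedding : K.IsEmbedding
  vert_notMem : ∀ v, K.vert v ∉ Γ.image
  vert_unique : ∀ f, Γ.IsFace f → ∃! v, K.vert v ∈ f
  crosses_only : ∀ e e' s t, Γ.edge e s = K.edge e' t → e = e'
  crosses : ∀ e, CrossesRightToLeft (Γ.edge e) (K.edge e)
  primal_unique : ∀ g, K.IsFace g → ∃! p, Γ.vert p ∈ g

/-! ### Force diagrams -/

/-- The counterclockwise rotation of the plane by a quarter circle. -/
def quarterTurn : Matrix (Fin 2) (Fin 2) ℝ := !![0, -1; 1, 0]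

/-- Let `D` be the native displacement matrix of a geodesic drawing with stress `ω`, and let `K`
be the natural embedding on the square flat torus of the dual graph. The drawing `H` of the dual
graph on `FlatTorus N` is an orthogonal force diagram: it is dual to `G`, which means that `H` is
homotopic to the image of `K` on `FlatTorus N` (for `N` nonsingular, that the image of `H` on the
square torus is homotopic to `K`); and it is geodesic, the dual of each edge `e` being orthogonal to
`e` and of signed length `ω e` times the length of `e`: its displacement vector is the
counterclockwise quarter turn of `ω e` times the displacement vector of `e`. -/
structure IsOrthogonalForceDiagram {F E : Type*} [Fintype E] [DecidableEq E] {G' : Multigraph F E}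
    {N : Matrix (Fin 2) (Fin 2) ℝ} (H : Drawing G' (FlatTorus N)) (K : Drawing G' (FlatTorus 1))
    (D : Matrix (Fin 2) E ℝ) (ω : E → ℝ) : Prop where
  homotopic : H.Homotopic (K.map (FlatTorus.ofSquare N))
  displacement : H.IsGeodesicWith (quarterTurn * D * Matrix.diagonal ω)

/-! ### Continuous logarithms -/

/-! A drawing of the dual with prescribed displacements $D_{e'}$ exists in the homotopy class of $K$
on $\mathbb{T}_N$ if $D_{e'} = N a_{e'} +$ (a coboundary of the dual graph), where $a_{e'}$ is the
integer displacement of a lift of $e'$; a straight-line homotopy in the plane realizes it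
(`Drawing.IsLift.exists_isGeodesicWith`).

The topological input is that $\delta_{ee'}$, the number of signed crossings of $e$ and $e'^*$,
equals $\det(b_e, a_{e'})$ up to a coboundary in each graph, with $b_e$ the integer displacement of
$e$ (`IsNaturalDual.exists_intersection_eq`). Homotopy invariance replaces $b$ by $\Delta$, again up
to a coboundary of $G$ (`Drawing.IsGeodesicWith.exists_eq_add_sub`). Now write column $e'$ of
$JM\Delta\Omega$ as $\sum_e \omega_e JM\Delta_e\,\delta_{ee'}$ and substitute: the determinants give
$N a_{e'}$, equilibrium kills the coboundaries of $G$, and the coboundary of the dual graph remains.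

The intersection formula is an argument principle. A theta-like function vanishing exactly on
$\mathbb{Z}^2$ is evaluated at $\gamma_e(s)-\kappa_{e'}(t)$; its logarithm changes around the
boundary of the square of all $(s,t)$ by $2\pi i$ times the crossing number, while its
quasi-periodicity turns the four sides into the determinant and the coboundaries. -/

theorem exists_continuous_log {A : Type*} [NormedAddCommGroup A] [NormedSpace ℝ A] {f : A → ℂ}
    (hf : Continuous f) (h : ∀ a, f a ≠ 0) :
    ∃ L : A → ℂ, Continuous L ∧ ∀ a, Complex.exp (L a) = f a := by
  -- A normed space is simply connected, so `f` lifts through the covering `exp`.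
  obtain ⟨L, -, hL⟩ := (Complex.isCoveringMapOn_exp.existsUnique_continuousMap_lifts ⟨f, hf⟩
    (a₀ := 0) (Complex.exp_log (h 0)) h).exists
  exact ⟨L, L.continuous, fun a => congrFun hL a⟩

theorem eq_of_continuous_of_forall_int {A : Type*} [TopologicalSpace A] [PreconnectedSpace A]
    {h : A → ℝ} (hc : Continuous h) (hint : ∀ a, ∃ n : ℤ, h a = n) (a b : A) : h a = h b := by
  choose n hn using hint
  have hn' : Continuous n := by
    rw [Int.isClosedEmbedding_coe_real.isEmbedding.continuous_iff]
    exact hc.congr hn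
  rw [hn, hn, PreconnectedSpace.constant ‹_› hn' (x := a) (y := b)]

/-- Two logarithms differ by a continuous function with values in the discrete set $2\pi
i\mathbb{Z}$. -/
theorem sub_eq_sub_of_exp_eq {A : Type*} [TopologicalSpace A] [PreconnectedSpace A] {L L' : A → ℂ}
    (hL : Continuous L) (hL' : Continuous L') (h : ∀ a, Complex.exp (L a) = Complex.exp (L' a))
    (a b : A) : L a - L' a = L b - L' b := by
  have key : ∀ a, ∃ n : ℤ, L a - L' a = n * (2 * Real.pi * Complex.I) := fun a => by
    obtain ⟨n, hn⟩ := Complex.exp_eq_exp_iff_exists_int.1 (h a)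
    exact ⟨n, by rw [hn]; ring⟩
  have hpi : (2 * Real.pi : ℝ) ≠ 0 := by positivity
  have him : (L a - L' a).im / (2 * Real.pi) = (L b - L' b).im / (2 * Real.pi) := by
    refine eq_of_continuous_of_forall_int (h := fun a => (L a - L' a).im / (2 * Real.pi))
      (by fun_prop) (fun a => ?_) a b
    obtain ⟨n, hn⟩ := key a
    exact ⟨n, by rw [hn]; simp⟩
  obtain ⟨n, hn⟩ := key a
  obtain ⟨m, hm⟩ := key b
  apply Complex.ext
  · rw [hn, hm]; simp
  · field_simp at him; exact him

/-- A continuous logarithm of the path `φ` changes by `c` from the beginning to the end. -/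
def HasLogChange (φ : unitInterval → ℂ) (c : ℂ) : Prop :=
  ∃ L : unitInterval → ℂ, Continuous L ∧ (∀ t, Complex.exp (L t) = φ t) ∧ L 1 - L 0 = c

namespace HasLogChange

theorem unique {φ : unitInterval → ℂ} {c c' : ℂ} (h : HasLogChange φ c) (h' : HasLogChange φ c') :
    c = c' := by
  obtain ⟨L, hL, hφ, rfl⟩ := h
  obtain ⟨L', hL', hφ', rfl⟩ := h'
  have := sub_eq_sub_of_exp_eq hL hL' (fun t => (hφ t).trans (hφ' t).symm) 0 1
  linear_combination -this

theorem mul {φ ψ : unitInterval → ℂ} {c d : ℂ} (h : HasLogChange φ c) (h' : HasLogChange ψ d) :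
    HasLogChange (fun t => φ t * ψ t) (c + d) := by
  obtain ⟨L, hL, hφ, rfl⟩ := h
  obtain ⟨L', hL', hφ', rfl⟩ := h'
  exact ⟨fun t => L t + L' t, hL.add hL', fun t => by rw [Complex.exp_add, hφ, hφ'], by ring⟩

theorem exp {ℓ : unitInterval → ℂ} (h : Continuous ℓ) :
    HasLogChange (fun t => Complex.exp (ℓ t)) (ℓ 1 - ℓ 0) :=
  ⟨ℓ, h, fun _ => rfl, rfl⟩

theorem congr {φ ψ : unitInterval → ℂ} {c d : ℂ} (h : HasLogChange φ c) (hφ : ∀ t, φ t = ψ t)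
    (hc : c = d) : HasLogChange ψ d := by
  rwa [← hc, ← funext hφ]

end HasLogChange

theorem exists_hasLogChange {φ : unitInterval → ℂ} (hφ : Continuous φ) (h : ∀ t, φ t ≠ 0) :
    ∃ c, HasLogChange φ c := by
  -- Clamping extends `φ` to the whole line, where a logarithm exists.
  obtain ⟨L, hL, hexp⟩ := exists_continuous_log
    (f := fun x : ℝ => φ (projIcc 0 1 zero_le_one x)) (by fun_prop) (fun _ => h _)
  exact ⟨_, fun t => L t, by fun_prop, fun t => by rw [hexp, projIcc_val], rfl⟩

/-! ### Winding numbers around a square -/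

/-- The change of the logarithm around the boundary of a square vanishes for a function without
zeros. -/
theorem boundary_logChange_eq_zero {g : unitInterval × unitInterval → ℂ} (hg : Continuous g)
    (h : ∀ q, g q ≠ 0) {c₀ c₁ d₀ d₁ : ℂ}
    (hc₀ : HasLogChange (fun s => g (s, 0)) c₀) (hc₁ : HasLogChange (fun s => g (s, 1)) c₁)
    (hd₀ : HasLogChange (fun t => g (0, t)) d₀) (hd₁ : HasLogChange (fun t => g (1, t)) d₁) :
    c₁ - d₁ - c₀ + d₀ = 0 := by
  obtain ⟨L, hL, hexp⟩ := exists_continuous_log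
    (f := fun x : ℝ × ℝ => g (projIcc 0 1 zero_le_one x.1, projIcc 0 1 zero_le_one x.2))
    (by fun_prop) (fun _ => h _)
  have e : ∀ s t : unitInterval, Complex.exp (L (s, t)) = g (s, t) := fun s t => by
    rw [hexp]; simp
  -- A single logarithm on the whole square serves all four sides, so the corner values telescope.
  rw [hc₀.unique ⟨fun s => L (s, (0 : unitInterval)), by fun_prop, fun s => e s 0, rfl⟩,
    hc₁.unique ⟨fun s => L (s, (1 : unitInterval)), by fun_prop, fun s => e s 1, rfl⟩,
    hd₀.unique ⟨fun t => L ((0 : unitInterval), t), by fun_prop, fun t => e 0 t, rfl⟩,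
    hd₁.unique ⟨fun t => L ((1 : unitInterval), t), by fun_prop, fun t => e 1 t, rfl⟩]
  ring

/-- The change of the logarithm around the boundary of a square, for a function with a single
zero, is given by the winding number of a small circle around the zero. -/
theorem boundary_logChange_eq {g : unitInterval × unitInterval → ℂ} (hg : Continuous g)
    {s₀ t₀ : unitInterval} (hs₀ : s₀ ∈ Ioo (0 : unitInterval) 1) (ht₀ : t₀ ∈ Ioo (0 : unitInterval) 1)
    (h : ∀ s t, g (s, t) = 0 → s = s₀ ∧ t = t₀) {r : ℝ} (hr : 0 < r) {k : ℤ}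
    (hk : HasWindingNumber (fun u =>
      g (projIcc 0 1 zero_le_one (s₀ + r * Real.cos (2 * Real.pi * u)),
        projIcc 0 1 zero_le_one (t₀ - r * Real.sin (2 * Real.pi * u)))) k)
    {c₀ c₁ d₀ d₁ : ℂ}
    (hc₀ : HasLogChange (fun s => g (s, 0)) c₀) (hc₁ : HasLogChange (fun s => g (s, 1)) c₁)
    (hd₀ : HasLogChange (fun t => g (0, t)) d₀) (hd₁ : HasLogChange (fun t => g (1, t)) d₁) :
    c₁ - d₁ - c₀ + d₀ = k * (2 * Real.pi * Complex.I) := by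
  have hs0 : (0 : ℝ) < s₀ := hs₀.1
  have hs1 : (s₀ : ℝ) < 1 := hs₀.2
  have ht0 : (0 : ℝ) < t₀ := ht₀.1
  have ht1 : (t₀ : ℝ) < 1 := ht₀.2
  -- pull back by `w ↦ (s₀, t₀) + conj (exp w)`
  set P : ℂ → unitInterval × unitInterval := fun z =>
    (projIcc 0 1 zero_le_one (s₀ + z.re), projIcc 0 1 zero_le_one (t₀ - z.im)) with hP
  have hPc : Continuous P := by fun_prop
  -- Clamping adds no preimages of an interior point, so `P` takes the value `(s₀, t₀)` only at `0`,
  -- which `exp` omits.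
  have hproj : ∀ x : ℝ, ∀ y : unitInterval, y ∈ Ioo (0 : unitInterval) 1 →
      projIcc 0 1 zero_le_one x = y → x = y := by
    intro x y hy hxy
    have h1 := congrArg Subtype.val hxy
    rw [coe_projIcc] at h1
    have hy0 : (0 : ℝ) < y := hy.1
    have hy1 : (y : ℝ) < 1 := hy.2
    rcases le_total x 0 with hx | hx
    · rw [min_eq_right (by linarith), max_eq_left hx] at h1; linarith
    · rcases le_total 1 x with hx' | hx'
      · rw [min_eq_left hx', max_eq_right zero_le_one] at h1; linarith
      · rwa [min_eq_right hx', max_eq_right hx] at h1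
  obtain ⟨L, hL, hexp⟩ := exists_continuous_log (f := fun w : ℂ => g (P (Complex.exp w)))
    (by fun_prop) (fun w hw => by
      obtain ⟨h1, h2⟩ := h _ _ hw
      have h3 := hproj _ _ hs₀ h1
      have h4 := hproj _ _ ht₀ h2
      exact Complex.exp_ne_zero w (Complex.ext (by simpa using h3) (by simpa using h4)))
  have hlog : ∀ z : ℂ, z ≠ 0 → Complex.exp (L (Complex.log z)) = g (P z) := fun z hz => by
    rw [hexp, Complex.exp_log hz]
  -- monodromy of the logarithm
  have hper : ∀ w, L (w + 2 * Real.pi * Complex.I) - L w = k * (2 * Real.pi * Complex.I) := by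
    intro w
    -- The increment does not depend on `w`; at `w = log r` the vertical segment of length $2\pi$
    -- runs once around the circle of radius `r`.
    rw [sub_eq_sub_of_exp_eq (L := fun w => L (w + 2 * Real.pi * Complex.I)) (L' := L)
      (by fun_prop) hL (fun w => by rw [hexp, hexp, Complex.exp_periodic]) w (Real.log r)]
    obtain ⟨L', hL', hexp', hk'⟩ := hk
    have hcon := HasLogChange.unique
      (φ := fun u => g (P (Complex.exp ((Real.log r : ℂ) + 2 * Real.pi * Complex.I * (u : ℝ)))))
      ⟨fun u => L ((Real.log r : ℂ) + 2 * Real.pi * Complex.I * (u : ℝ)), by fun_prop,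
        fun u => hexp _, rfl⟩
      ⟨fun u => L' u, hL'.domRestrict, fun u => by
        refine (hexp' u u.2).trans ?_
        have : Complex.exp ((Real.log r : ℂ) + 2 * Real.pi * Complex.I * (u : ℝ))
            = r * Complex.exp ((2 * Real.pi * u : ℝ) * Complex.I) := by
          rw [Complex.exp_add, ← Complex.ofReal_exp, Real.exp_log hr]
          congr 2; push_cast; ring
        simp only [this, hP, Complex.re_ofReal_mul, Complex.im_ofReal_mul,
          Complex.exp_ofReal_mul_I_re, Complex.exp_ofReal_mul_I_im], rfl⟩
    simp only [Set.Icc.coe_one, Set.Icc.coe_zero, Complex.ofReal_one, Complex.ofReal_zero,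
      mul_one, mul_zero, add_zero] at hcon
    rw [hcon]; exact hk'
  have hslit : ∀ x : unitInterval → ℂ, Continuous x → (∀ u, x u ∈ Complex.slitPlane) →
      Continuous fun u => L (Complex.log (x u)) := fun x hx hm => hL.comp (hx.clog hm)
  have hPst : ∀ s t : unitInterval, P ⟨s - s₀, t₀ - t⟩ = (s, t) := fun s t => by
    simp [hP]
  have hb : ∀ s : unitInterval, (⟨s - s₀, t₀ - 1⟩ : ℂ) ∈ Complex.slitPlane := fun s =>
    Or.inr (show (t₀ - 1 : ℝ) ≠ 0 from (sub_neg.2 ht1).ne)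
  have ht : ∀ s : unitInterval, (⟨s - s₀, t₀ - 0⟩ : ℂ) ∈ Complex.slitPlane := fun s =>
    Or.inr (show (t₀ - 0 : ℝ) ≠ 0 from (sub_pos.2 ht0).ne')
  have hrt : ∀ t : unitInterval, (⟨1 - s₀, t₀ - t⟩ : ℂ) ∈ Complex.slitPlane := fun s =>
    Or.inl (show (0 : ℝ) < 1 - s₀ by linarith)
  -- In the coordinate $z = (s-s_0) + i(t_0-t)$ only the side `s = 0` meets the branch cut; there
  -- `log (-z) + π I` replaces `log z`.
  have hl : ∀ t : unitInterval, (-⟨0 - s₀, t₀ - t⟩ : ℂ) ∈ Complex.slitPlane := fun s =>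
    Or.inl (show (0 : ℝ) < -(0 - s₀) by linarith)
  have hcont : ∀ a b : unitInterval → ℝ, Continuous a → Continuous b →
      Continuous fun u => (⟨a u, b u⟩ : ℂ) := fun a b ha hb =>
    (Complex.equivRealProdCLM.symm.continuous.comp (ha.prodMk hb))
  have e₀ := hc₀.unique ⟨fun s => L (Complex.log ⟨s - s₀, t₀ - 0⟩),
    hslit _ (hcont _ _ (by fun_prop) (by fun_prop)) ht, fun s => by
      rw [hlog _ (Complex.slitPlane_ne_zero (ht s))]
      exact congrArg g (hPst s 0), rfl⟩
  have e₁ := hc₁.unique ⟨fun s => L (Complex.log ⟨s - s₀, t₀ - 1⟩),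
    hslit _ (hcont _ _ (by fun_prop) (by fun_prop)) hb, fun s => by
      rw [hlog _ (Complex.slitPlane_ne_zero (hb s))]
      exact congrArg g (hPst s 1), rfl⟩
  have f₁ := hd₁.unique ⟨fun t => L (Complex.log ⟨1 - s₀, t₀ - t⟩),
    hslit _ (hcont _ _ (by fun_prop) (by fun_prop)) hrt, fun t => by
      rw [hlog _ (Complex.slitPlane_ne_zero (hrt t))]
      exact congrArg g (hPst 1 t), rfl⟩
  have f₀ := hd₀.unique ⟨fun t => L (Complex.log (-⟨0 - s₀, t₀ - t⟩) + Real.pi * Complex.I),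
    hL.comp ((((hcont _ _ (by fun_prop) (by fun_prop)).neg).clog hl).add continuous_const),
    fun t => by
      rw [hexp, Complex.exp_add, Complex.exp_log (Complex.slitPlane_ne_zero (hl t)),
        Complex.exp_pi_mul_I, neg_mul_neg, mul_one]
      exact congrArg g (hPst 0 t), rfl⟩
  -- The replacement agrees with `log z` at the corner above the cut and exceeds it by $2\pi i$ at
  -- the corner below; this jump is the monodromy `hper`.
  have htl : Complex.log (-⟨0 - s₀, t₀ - 0⟩) + Real.pi * Complex.I
      = Complex.log ⟨0 - s₀, t₀ - 0⟩ := by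
    rw [Complex.log, Complex.log, norm_neg, Complex.arg_neg_eq_arg_sub_pi_of_im_pos (sub_pos.2 ht0)]
    push_cast; ring
  have hbl : Complex.log (-⟨0 - s₀, t₀ - 1⟩) + Real.pi * Complex.I
      = Complex.log ⟨0 - s₀, t₀ - 1⟩ + 2 * Real.pi * Complex.I := by
    rw [Complex.log, Complex.log, norm_neg,
      Complex.arg_neg_eq_arg_add_pi_of_im_neg (sub_neg.2 ht1)]
    push_cast; ring
  simp only [Set.Icc.coe_one, Set.Icc.coe_zero] at e₀ e₁ f₀ f₁
  rw [htl, hbl] at f₀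
  rw [← hper (Complex.log ⟨0 - s₀, t₀ - 1⟩), e₀, e₁, f₀, f₁]
  ring

/-- Closed curves whose quotient stays in the right half-plane have equal winding numbers. -/
theorem HasWindingNumber.of_re_mul_conj_pos {φ ψ : ℝ → ℂ} {n : ℤ} (h : HasWindingNumber φ n)
    (hφ : ContinuousOn φ (Icc 0 1)) (hψ : ContinuousOn ψ (Icc 0 1)) (hφ₁ : φ 0 = φ 1)
    (hψ₁ : ψ 0 = ψ 1) (hpos : ∀ u ∈ Icc (0 : ℝ) 1, 0 < (ψ u * star (φ u)).re) :
    HasWindingNumber ψ n := by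
  obtain ⟨L, hL, hexp, hn⟩ := h
  have h0 : ∀ u ∈ Icc (0 : ℝ) 1, φ u ≠ 0 := fun u hu => by
    rw [← hexp u hu]; exact Complex.exp_ne_zero _
  have hq : ∀ u ∈ Icc (0 : ℝ) 1, ψ u / φ u ∈ Complex.slitPlane := fun u hu => by
    refine Or.inl ?_
    have h1 := hpos u hu
    rw [Complex.div_re, ← add_div]
    apply div_pos _ (Complex.normSq_pos.2 (h0 u hu))
    simpa [Complex.mul_re] using h1
  refine ⟨fun u => L u + Complex.log (ψ u / φ u), hL.add ((hψ.div hφ h0).clog hq), fun u hu => ?_, ?_⟩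
  · rw [Complex.exp_add, hexp u hu, Complex.exp_log (Complex.slitPlane_ne_zero (hq u hu)),
      mul_div_cancel₀ _ (h0 u hu)]
  · simp only [hφ₁, hψ₁]
    rw [← hn]; ring

/-! ### A quasi-periodic function with simple zeros at the integer points -/

/-- A continuous function on the plane, periodic in the first coordinate and quasi-periodic in the
second, whose zeros are the integer points. -/
noncomputable def latticeTheta (w : Fin 2 → ℝ) : ℂ :=
  -Complex.I * Complex.exp (-(2 * Real.pi * Complex.I * (w 0 + 1 / 2 : ℝ) * ⌊w 1 + 1 / 2⌋)) *
    ((1 - Int.fract (w 1 + 1 / 2) : ℝ) + (Int.fract (w 1 + 1 / 2) : ℝ) *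
      Complex.exp (-(2 * Real.pi * Complex.I * (w 0 + 1 / 2 : ℝ))))

/-- With $x = w_0 + 1/2$ and $y = w_1 + 1/2$, the function is $-i\,e^{-2\pi i x y}$ times a function
of the fractional part of $y$ that takes the value 1 at both 0 and 1, so the jumps of the floor are
invisible. -/
theorem continuous_latticeTheta : Continuous latticeTheta := by
  let P : (Fin 2 → ℝ) → ℝ → ℂ := fun w f => ((1 - f : ℝ) + (f : ℝ) *
    Complex.exp (-(2 * Real.pi * Complex.I * (w 0 + 1 / 2 : ℝ)))) *
    Complex.exp (2 * Real.pi * Complex.I * (w 0 + 1 / 2 : ℝ) * f)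
  have hP : Continuous (Function.uncurry P) := by
    unfold P Function.uncurry
    fun_prop
  have hper : Continuous fun w => P w (Int.fract (w 1 + 1 / 2)) :=
    ContinuousOn.comp_fract hP.continuousOn (by fun_prop) fun w => by simp [P, ← Complex.exp_add]
  refine ((continuous_const (y := -Complex.I)).mul ((Complex.continuous_exp.comp
    (f := fun w : Fin 2 → ℝ => -(2 * Real.pi * Complex.I * (w 0 + 1 / 2 : ℝ) * (w 1 + 1 / 2 : ℝ)))
    (by fun_prop)).mul hper)).congr fun w => ?_
  have hfl : (w 1 + 1 / 2 : ℝ) = ⌊w 1 + 1 / 2⌋ + Int.fract (w 1 + 1 / 2) :=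
    (Int.floor_add_fract _).symm
  have h2 : Complex.exp (-(2 * Real.pi * Complex.I * (w 0 + 1 / 2 : ℝ) * ⌊w 1 + 1 / 2⌋))
      = Complex.exp (-(2 * Real.pi * Complex.I * (w 0 + 1 / 2 : ℝ) * (w 1 + 1 / 2 : ℝ))) *
        Complex.exp (2 * Real.pi * Complex.I * (w 0 + 1 / 2 : ℝ) * Int.fract (w 1 + 1 / 2)) := by
    rw [← Complex.exp_add]
    congr 1
    conv_rhs => rw [hfl]
    push_cast
    rw [← hfl]
    ring
  simp only [latticeTheta, h2, P, Pi.mul_apply, Function.comp_apply]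
  ring

/-- The vertical translation contributes the only nontrivial factor; its dependence on `w 0` is the
source of the determinant in the intersection formula. -/
theorem latticeTheta_add (w : Fin 2 → ℝ) (m : Fin 2 → ℤ) :
    latticeTheta (w + fun i => (m i : ℝ)) =
      Complex.exp (-(2 * Real.pi * Complex.I * m 1 * (w 0 + 1 / 2 : ℝ))) * latticeTheta w := by
  have hx : ∀ k : ℤ, Complex.exp (-(2 * Real.pi * Complex.I * ((w 0 + m 0) + 1 / 2 : ℝ) * k)) =
      Complex.exp (-(2 * Real.pi * Complex.I * (w 0 + 1 / 2 : ℝ) * k)) := fun k => by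
    rw [Complex.exp_eq_exp_iff_exists_int]
    exact ⟨-(m 0 * k), by push_cast; ring⟩
  have hx1 := hx 1
  simp only [Int.cast_one, mul_one] at hx1
  have hy : w 1 + m 1 + 1 / 2 = (w 1 + 1 / 2) + m 1 := by ring
  simp only [latticeTheta, Pi.add_apply, hx, hx1, hy, Int.fract_add_intCast, Int.floor_add_intCast]
  have h2 : Complex.exp (-(2 * Real.pi * Complex.I * (w 0 + 1 / 2 : ℝ) *
        ((⌊w 1 + 1 / 2⌋ + m 1 : ℤ) : ℂ)))
      = Complex.exp (-(2 * Real.pi * Complex.I * m 1 * (w 0 + 1 / 2 : ℝ))) *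
        Complex.exp (-(2 * Real.pi * Complex.I * (w 0 + 1 / 2 : ℝ) * ⌊w 1 + 1 / 2⌋)) := by
    rw [← Complex.exp_add]
    push_cast
    ring_nf
  rw [h2]
  ring

/-- A convex combination of 1 and a number of modulus 1 vanishes only at the midpoint, and only if
that number is $-1$. -/
theorem latticeTheta_eq_zero {w : Fin 2 → ℝ} (h : latticeTheta w = 0) :
    ∃ m : Fin 2 → ℤ, w = fun i => (m i : ℝ) := by
  have h1 : ((1 - Int.fract (w 1 + 1 / 2) : ℝ) : ℂ) + (Int.fract (w 1 + 1 / 2) : ℝ) *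
      Complex.exp (-(2 * Real.pi * Complex.I * (w 0 + 1 / 2 : ℝ))) = 0 := by
    simpa [latticeTheta] using h
  set f := Int.fract (w 1 + 1 / 2) with hf
  have hf0 : 0 ≤ f := Int.fract_nonneg _
  have hf1 : f < 1 := Int.fract_lt_one _
  have hexp : ‖Complex.exp (-(2 * Real.pi * Complex.I * (w 0 + 1 / 2 : ℝ)))‖ = 1 := by
    rw [Complex.norm_exp]
    simp
  have h2 : f = 1 / 2 := by
    have h3 := congrArg norm (eq_neg_of_add_eq_zero_left h1)
    rw [norm_neg, norm_mul, hexp, Complex.norm_real, Complex.norm_real, Real.norm_of_nonneg hf0,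
      Real.norm_of_nonneg (by linarith)] at h3
    linarith
  have h4 : Complex.exp (-(2 * Real.pi * Complex.I * w 0)) = 1 := by
    have h5 : Complex.exp (-(2 * Real.pi * Complex.I * (w 0 + 1 / 2 : ℝ)))
        = Complex.exp (-(2 * Real.pi * Complex.I * w 0)) * -1 := by
      rw [← Complex.exp_neg_pi_mul_I, ← Complex.exp_add]
      push_cast
      ring_nf
    rw [h5, h2] at h1
    push_cast at h1
    linear_combination -2 * h1
  obtain ⟨n, hn⟩ := Complex.exp_eq_one_iff.1 h4
  have h6 : w 0 = (-n : ℤ) := by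
    have h7 : (2 * Real.pi * Complex.I) * (w 0 + n) = 0 := by linear_combination -hn
    have h8 := (mul_eq_zero.1 h7).resolve_left Complex.two_pi_I_ne_zero
    have h9 : w 0 + n = 0 := by exact_mod_cast h8
    push_cast
    linarith
  have h10 : w 1 = ⌊w 1 + 1 / 2⌋ := by
    have := Int.floor_add_fract (w 1 + 1 / 2)
    rw [← hf, h2] at this
    linarith
  refine ⟨![-n, ⌊w 1 + 1 / 2⌋], ?_⟩
  ext i
  fin_cases i
  · exact h6
  · exact h10

/-- Near the origin the function is approximately $\pi w_0 + 2 i w_1$, thanks to the factor $-i$, so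
it stays within a right angle of $w_0 + i w_1$. Hence its zero there has index $+1$. -/
theorem latticeTheta_mul_conj_pos {w : Fin 2 → ℝ} (h : w ≠ 0) (h0 : |w 0| ≤ 1 / 20)
    (h1 : |w 1| ≤ 1 / 20) : 0 < (latticeTheta w * star (planePoint w)).re := by
  obtain ⟨ha, ha'⟩ := abs_le.1 h0
  obtain ⟨hb, hb'⟩ := abs_le.1 h1
  have hfl : ⌊w 1 + 1 / 2⌋ = 0 := Int.floor_eq_zero_iff.2 ⟨by linarith, by linarith⟩
  have hfr : Int.fract (w 1 + 1 / 2) = w 1 + 1 / 2 :=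
    Int.fract_eq_self.2 ⟨by linarith, by linarith⟩
  have hE : Complex.exp (-(2 * Real.pi * Complex.I * (w 0 + 1 / 2 : ℝ)))
      = -(⟨Real.cos (2 * Real.pi * w 0), -Real.sin (2 * Real.pi * w 0)⟩ : ℂ) := by
    have : -(2 * Real.pi * Complex.I * (w 0 + 1 / 2 : ℝ))
        = ((-(2 * Real.pi * w 0) : ℝ) : ℂ) * Complex.I - Real.pi * Complex.I := by
      push_cast; ring
    rw [this, Complex.exp_sub_pi_mul_I]
    congr 1
    apply Complex.ext
    · rw [Complex.exp_ofReal_mul_I_re, Real.cos_neg]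
    · rw [Complex.exp_ofReal_mul_I_im, Real.sin_neg]
  have hre : (latticeTheta w * star (planePoint w)).re =
      w 1 * (w 1 * (1 + Real.cos (2 * Real.pi * w 0)) - (1 - Real.cos (2 * Real.pi * w 0)) / 2)
        + (w 1 + 1 / 2) * (w 0 * Real.sin (2 * Real.pi * w 0)) := by
    simp only [latticeTheta, hfl, hfr, hE, planePoint]
    simp
    ring
  have hpi := Real.pi_pos
  have hpi4 := Real.pi_le_four
  have hsin : 4 * (w 0 ^ 2) ≤ w 0 * Real.sin (2 * Real.pi * w 0) := by
    have hpos : ∀ x : ℝ, 0 ≤ x → x ≤ 1 / 20 → 4 * x ≤ Real.sin (2 * Real.pi * x) := by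
      intro x hx hx'
      have := Real.mul_le_sin (x := 2 * Real.pi * x) (by positivity) (by nlinarith)
      refine le_trans (le_of_eq ?_) this
      field_simp
      ring
    rcases le_total 0 (w 0) with hw | hw
    · nlinarith [hpos _ hw ha']
    · have := hpos (-w 0) (by linarith) (by linarith)
      rw [mul_neg, mul_neg, Real.sin_neg] at this
      nlinarith
  have hcos : 1 - 32 * w 0 ^ 2 ≤ Real.cos (2 * Real.pi * w 0) := by
    have := Real.one_sub_sq_div_two_le_cos (x := 2 * Real.pi * w 0)
    have : Real.pi ^ 2 ≤ 16 := by nlinarith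
    nlinarith [sq_nonneg (w 0)]
  have hcos1 := Real.cos_le_one (2 * Real.pi * w 0)
  rw [hre]
  set c := Real.cos (2 * Real.pi * w 0)
  set a := w 0
  set b := w 1
  -- The bound $1/20$ makes the first term of `hre` at least $b^2 - \tfrac45 a^2$ and the second at
  -- least $\tfrac95 a^2$, so the real part is at least $a^2 + b^2$.
  have ha2 : a ^ 2 ≤ 1 / 400 := by nlinarith
  have hA : b ^ 2 ≤ b ^ 2 * (1 + c) := by nlinarith [sq_nonneg b]
  have hB : -(16 * a ^ 2 / 20) ≤ -(b * ((1 - c) / 2)) := by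
    have : 0 ≤ (1 - c) / 2 := by linarith
    have : (1 - c) / 2 ≤ 16 * a ^ 2 := by linarith
    nlinarith [sq_nonneg a]
  have hC : 9 / 20 * (4 * a ^ 2) ≤ (b + 1 / 2) * (a * Real.sin (2 * Real.pi * a)) :=
    mul_le_mul (by linarith) hsin (by positivity) (by linarith)
  have hab : 0 < a ^ 2 + b ^ 2 := by
    by_contra hcon
    apply h
    have h1 : a = 0 := by nlinarith [sq_nonneg a, sq_nonneg b]
    have h2 : b = 0 := by nlinarith [sq_nonneg a, sq_nonneg b]
    ext i
    fin_cases i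
    · exact h1
    · exact h2
  nlinarith [sq_nonneg a, sq_nonneg b]

/-! ### Lifting from flat tori to the plane -/

theorem mem_latticeOf {M : Matrix (Fin 2) (Fin 2) ℝ} {v : Fin 2 → ℝ} :
    v ∈ latticeOf M ↔ ∃ a : Fin 2 → ℤ, v = M *ᵥ fun i => (a i : ℝ) :=
  Iff.rfl

theorem mem_latticeOf_one {v : Fin 2 → ℝ} :
    v ∈ latticeOf 1 ↔ ∃ a : Fin 2 → ℤ, v = fun i => (a i : ℝ) := by
  simp [mem_latticeOf]

namespace FlatTorus

variable {M : Matrix (Fin 2) (Fin 2) ℝ}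

theorem proj_eq_proj_iff {x y : Fin 2 → ℝ} : proj M x = proj M y ↔ y - x ∈ latticeOf M := by
  rw [proj, proj, QuotientAddGroup.eq, neg_add_eq_sub]

theorem continuous_proj : Continuous (proj M) := continuous_quot_mk

theorem proj_surjective : Function.Surjective (proj M) := QuotientAddGroup.mk_surjective

theorem isDiscrete_latticeOf (hM : M.det ≠ 0) : IsDiscrete (latticeOf M : Set (Fin 2 → ℝ)) := by
  have hcast : IsEmbedding fun (a : Fin 2 → ℤ) i => (a i : ℝ) :=
    IsEmbedding.piMap fun _ => Int.isClosedEmbedding_coe_real.isEmbedding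
  have hmul : IsEmbedding fun v => M *ᵥ v :=
    Function.LeftInverse.isEmbedding (f := fun v => M⁻¹ *ᵥ v)
      (fun v => by
        simp only [mulVec_mulVec, nonsing_inv_mul _ (isUnit_iff_ne_zero.2 hM), one_mulVec])
      (by fun_prop) (by fun_prop)
  have h := IsDiscrete.univ.image (hmul.comp hcast).isInducing
  convert h using 1
  ext v
  simp [mem_latticeOf, eq_comm]

/-- Nonsingularity makes the lattice discrete, hence the projection a covering, and the domain is
simply connected. -/
theorem exists_lift (hM : M.det ≠ 0) {A : Type*} [NormedAddCommGroup A] [NormedSpace ℝ A]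
    {f : A → FlatTorus M} (hf : Continuous f) :
    ∃ g : A → Fin 2 → ℝ, Continuous g ∧ ∀ a, proj M (g a) = f a := by
  obtain ⟨x, hx⟩ := proj_surjective (f 0)
  obtain ⟨g, -, hg⟩ := ((latticeOf M).isAddQuotientCoveringMap_of_comm
    (isDiscrete_latticeOf hM)).isCoveringMap.existsUnique_continuousMap_lifts ⟨f, hf⟩
    0 x hx |>.exists
  exact ⟨g, g.continuous, fun a => congrFun hg a⟩

/-- A continuous function with values in a lattice is constant. -/
theorem eq_of_continuous_of_mem_latticeOf (hM : M.det ≠ 0) {A : Type*} [TopologicalSpace A]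
    [PreconnectedSpace A] {f : A → Fin 2 → ℝ} (hf : Continuous f) (h : ∀ a, f a ∈ latticeOf M)
    (a b : A) : f a = f b := by
  have hinv : ∀ v : Fin 2 → ℝ, M *ᵥ (M⁻¹ *ᵥ v) = v := fun v => by
    rw [mulVec_mulVec, mul_nonsing_inv _ (isUnit_iff_ne_zero.2 hM), one_mulVec]
  rw [← hinv (f a), ← hinv (f b)]
  congr 1
  ext i
  refine eq_of_continuous_of_forall_int (h := fun a => (M⁻¹ *ᵥ f a) i) (by fun_prop)
    (fun a => ?_) a b
  obtain ⟨n, hn⟩ := h a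
  exact ⟨n i, by rw [hn, mulVec_mulVec, nonsing_inv_mul _ (isUnit_iff_ne_zero.2 hM), one_mulVec]⟩

theorem sub_eq_sub_of_proj_eq (hM : M.det ≠ 0) {A : Type*} [TopologicalSpace A]
    [PreconnectedSpace A] {f g : A → Fin 2 → ℝ} (hf : Continuous f) (hg : Continuous g)
    (h : ∀ a, proj M (f a) = proj M (g a)) (a b : A) : g a - f a = g b - f b :=
  eq_of_continuous_of_mem_latticeOf hM (f := fun a => g a - f a) (hg.sub hf)
    (fun a => proj_eq_proj_iff.1 (h a)) a b

end FlatTorus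

open FlatTorus

/-! ### Lifts of drawings and their integer displacements -/

namespace Drawing

variable {V E : Type*} {G : Multigraph V E}

@[ext]
theorem ext {X : Type*} [TopologicalSpace X] {D D' : Drawing G X} (hv : D.vert = D'.vert)
    (he : D.edge = D'.edge) : D = D' := by
  cases D; cases D'; cases hv; cases he; rfl

/-- A lift to the plane of a drawing on the square flat torus: the lift of the edge `e` leads from
the lift of its tail to the translate by the integer vector `b e` of the lift of its head. -/
structure IsLift (D : Drawing G (FlatTorus 1)) (p : V → Fin 2 → ℝ)
    (γ : E → unitInterval → Fin 2 → ℝ) (b : E → Fin 2 → ℤ) : Prop where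
  proj_vert : ∀ v, proj 1 (p v) = D.vert v
  continuous : ∀ e, Continuous (γ e)
  proj_edge : ∀ e t, proj 1 (γ e t) = D.edge e t
  zero : ∀ e, γ e 0 = p (G.tail e)
  one : ∀ e, γ e 1 = p (G.head e) + fun i => (b e i : ℝ)

theorem exists_isLift (D : Drawing G (FlatTorus 1)) : ∃ p γ b, D.IsLift p γ b := by
  choose p hp using fun v => proj_surjective (D.vert v)
  have key : ∀ e, ∃ γ : unitInterval → Fin 2 → ℝ, Continuous γ ∧
      (∀ t, proj 1 (γ t) = D.edge e t) ∧ γ 0 = p (G.tail e) := fun e => by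
    obtain ⟨g, hg, hgp⟩ := exists_lift (M := 1) (by simp)
      (f := fun x : ℝ => D.edge e (projIcc 0 1 zero_le_one x)) (by fun_prop)
    have h0 : p (G.tail e) - g 0 ∈ latticeOf 1 := by
      rw [← proj_eq_proj_iff, hp, hgp, projIcc_left]
      exact D.edge_zero e
    refine ⟨fun t => g t + (p (G.tail e) - g 0), by fun_prop, fun t => ?_, by simp⟩
    have : proj 1 (g t) = D.edge e t := by rw [hgp, projIcc_val]
    rw [← this, eq_comm, proj_eq_proj_iff]
    simpa using h0
  choose γ hγ hγp hγ0 using key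
  have hb : ∀ e, ∃ b : Fin 2 → ℤ, γ e 1 = p (G.head e) + fun i => (b i : ℝ) := fun e => by
    obtain ⟨b, hb⟩ := mem_latticeOf_one.1 (proj_eq_proj_iff.1
      (((hp _).trans (D.edge_one e).symm).trans (hγp e 1).symm))
    exact ⟨b, by rw [← hb]; simp⟩
  choose b hb using hb
  exact ⟨p, γ, b, hp, hγ, hγp, hγ0, hb⟩

/-- The displacement matrix of a geodesic drawing homotopic to an embedding agrees, up to a
coboundary, with the integer displacements of a lift of the embedding. -/
theorem IsGeodesicWith.exists_eq_add_sub {M : Matrix (Fin 2) (Fin 2) ℝ} (hM : M.det ≠ 0)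
    {Γ : Drawing G (FlatTorus M)} {Δ : Matrix (Fin 2) E ℝ} (hΔ : Γ.IsGeodesicWith (M * Δ))
    {Γ₀ : Drawing G (FlatTorus 1)} (hΓ : Γ.Homotopic (Γ₀.map (ofSquare M)))
    {p : V → Fin 2 → ℝ} {γ : E → unitInterval → Fin 2 → ℝ} {b : E → Fin 2 → ℤ}
    (hl : Γ₀.IsLift p γ b) :
    ∃ x : V → Fin 2 → ℝ, ∀ e i, (b e i : ℝ) = Δ i e + (x (G.head e) i - x (G.tail e) i) := by
  obtain ⟨F, hF0, hF1, hFv, hFe⟩ := hΓ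
  have hv : ∀ v, ∃ g : ℝ → Fin 2 → ℝ, Continuous g ∧
      ∀ u, proj M (g u) = (F (projIcc 0 1 zero_le_one u)).vert v := fun v =>
    exists_lift hM ((hFv v).comp continuous_projIcc)
  choose g hg hgp using hv
  have hMinv : ∀ v : Fin 2 → ℝ, M⁻¹ *ᵥ (M *ᵥ v) = v := fun v => by
    rw [mulVec_mulVec, nonsing_inv_mul _ (isUnit_iff_ne_zero.2 hM), one_mulVec]
  -- The potential is the motion of `v` during the homotopy, pulled back by `M`, corrected by the
  -- lift `p v` of its final position.
  refine ⟨fun v => M⁻¹ *ᵥ (g v 1 - g v 0) - p v, fun e i => ?_⟩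
  obtain ⟨h, hh, hhp⟩ := exists_lift hM (f := fun q : ℝ × ℝ =>
    (F (projIcc 0 1 zero_le_one q.1)).edge e (projIcc 0 1 zero_le_one q.2))
    ((hFe e).comp (f := Prod.map (projIcc 0 1 zero_le_one) (projIcc 0 1 zero_le_one))
      (continuous_projIcc.prodMap continuous_projIcc))
  -- the displacement relative to the vertices does not change
  have h1 := sub_eq_sub_of_proj_eq hM (hg (G.head e)) (g := fun u => h (u, 1)) (by fun_prop)
    (fun u => by rw [hgp, hhp, projIcc_right]; exact (Drawing.edge_one _ e).symm) 0 1
  have h0 := sub_eq_sub_of_proj_eq hM (hg (G.tail e)) (g := fun u => h (u, 0)) (by fun_prop)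
    (fun u => by rw [hgp, hhp, projIcc_left]; exact (Drawing.edge_zero _ e).symm) 0 1
  obtain ⟨x, hx⟩ := hΔ e
  have h2 := sub_eq_sub_of_proj_eq hM (A := unitInterval) (f := fun t => h (0, t))
    (g := fun t => x + (t : ℝ) • fun i => (M * Δ) i e) (by fun_prop) (by fun_prop)
    (fun t => by
      rw [hhp, projIcc_left, projIcc_val]
      change (F 0).edge e t = _
      rw [hF0]
      exact hx t) 0 1
  have h3 := sub_eq_sub_of_proj_eq hM (A := unitInterval) (f := fun t => h (1, t))
    (g := fun t => M *ᵥ γ e t) (by fun_prop)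
    ((M.mulVecLin.continuous_of_finiteDimensional).comp (hl.continuous e))
    (fun t => by
      rw [hhp, projIcc_right, projIcc_val]
      change (F 1).edge e t = _
      rw [hF1]
      exact congrArg (ofSquare M) (hl.proj_edge e t).symm) 0 1
  have hcol : (fun i => (M * Δ) i e) = M *ᵥ fun i => Δ i e := rfl
  simp only [hl.zero, hl.one, hcol, Set.Icc.coe_zero, Set.Icc.coe_one] at h2 h3
  have h4 : M *ᵥ (fun i => (b e i : ℝ)) = M *ᵥ (fun i => Δ i e)
      + ((g (G.head e) 1 - g (G.head e) 0 - M *ᵥ p (G.head e))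
        - (g (G.tail e) 1 - g (G.tail e) 0 - M *ᵥ p (G.tail e))) := by
    rw [mulVec_add] at h3
    simp only [one_smul, zero_smul] at h2
    ext i
    have a0 := congrFun h0 i
    have a1 := congrFun h1 i
    have a2 := congrFun h2 i
    have a3 := congrFun h3 i
    simp only [Pi.add_apply, Pi.sub_apply, Pi.zero_apply] at a0 a1 a2 a3 ⊢
    linarith
  have h5 := congrFun (congrArg (M⁻¹ *ᵥ ·) h4) i
  simpa only [mulVec_add, mulVec_sub, hMinv, Pi.add_apply, Pi.sub_apply] using h5

end Drawing

/-! ### Intersection numbers of the edges of dual graphs -/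

theorem continuous_planePoint : Continuous planePoint :=
  Complex.equivRealProdCLM.symm.continuous.comp
    (f := fun x : Fin 2 → ℝ => (x 0, x 1)) (by fun_prop)

theorem HasWindingNumber.exp_mul {φ ψ ℓ : ℝ → ℂ} {n : ℤ} (h : HasWindingNumber φ n)
    (hℓ : ContinuousOn ℓ (Icc 0 1)) (hℓ₁ : ℓ 0 = ℓ 1)
    (hψ : ∀ u ∈ Icc (0 : ℝ) 1, ψ u = Complex.exp (ℓ u) * φ u) : HasWindingNumber ψ n := by
  obtain ⟨L, hL, hexp, hn⟩ := h
  refine ⟨fun u => ℓ u + L u, hℓ.add hL, fun u hu => ?_, ?_⟩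
  · rw [Complex.exp_add, hexp u hu, hψ u hu]
  · simp only [hℓ₁]
    rw [← hn]; ring

/-- On a small circle `latticeTheta` and `planePoint` lie within a right angle of each other, so the
winding number carries over. Other lifts shift the argument by a fixed integer vector, which
multiplies by the exponential of a function that closes up around the circle. -/
theorem CrossesRightToLeft.exists_hasWindingNumber {c d : C(unitInterval, FlatTorus 1)}
    (h : CrossesRightToLeft c d) {γ κ : unitInterval → Fin 2 → ℝ} (hγ : Continuous γ)
    (hκ : Continuous κ) (hγp : ∀ s, proj 1 (γ s) = c s) (hκp : ∀ t, proj 1 (κ t) = d t) :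
    ∃ s₀ ∈ Ioo (0 : unitInterval) 1, ∃ t₀ ∈ Ioo (0 : unitInterval) 1,
      (∀ s t, c s = d t ↔ s = s₀ ∧ t = t₀) ∧ ∃ r : ℝ, 0 < r ∧ HasWindingNumber (fun u =>
        latticeTheta (γ (projIcc 0 1 zero_le_one (s₀ + r * Real.cos (2 * Real.pi * u)))
          - κ (projIcc 0 1 zero_le_one (t₀ - r * Real.sin (2 * Real.pi * u))))) 1 := by
  obtain ⟨s₀, hs₀, t₀, ht₀, hcd, c', d', hc', hd', hc'p, hd'p, hst, hev⟩ := h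
  refine ⟨s₀, hs₀, t₀, ht₀, hcd, ?_⟩
  have hdet : (1 : Matrix (Fin 2) (Fin 2) ℝ).det ≠ 0 := by simp
  -- near the crossing the given lifts are close to each other
  have hsmall : ∀ᶠ r in 𝓝[>] (0 : ℝ), ∀ u : ℝ,
      ‖c' (s₀ + r * Real.cos (2 * Real.pi * u)) - d' (t₀ - r * Real.sin (2 * Real.pi * u))‖
        ≤ 1 / 20 := by
    have hcont : Continuous fun q : ℝ × ℝ => c' (s₀ + q.1) - d' (t₀ - q.2) := by fun_prop
    obtain ⟨δ, hδ, hball⟩ := Metric.continuousAt_iff.1 (hcont.continuousAt (x := (0, 0)))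
      (1 / 20) (by norm_num)
    filter_upwards [Ioo_mem_nhdsGT hδ] with r hr u
    have hr' : ∀ x : ℝ, |x| ≤ 1 → |r * x| < δ := fun x hx => by
      rw [abs_mul, abs_of_pos hr.1]
      nlinarith [hr.1, hr.2]
    have := hball (x := (r * Real.cos (2 * Real.pi * u), r * Real.sin (2 * Real.pi * u))) (by
      rw [Prod.dist_eq, Real.dist_0_eq_abs, Real.dist_0_eq_abs]
      exact max_lt (hr' _ (Real.abs_cos_le_one _)) (hr' _ (Real.abs_sin_le_one _)))
    simpa [hst, dist_eq_norm] using this.le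
  have hs0 : (0 : ℝ) < s₀ := hs₀.1
  have hs1 : (0 : ℝ) < 1 - s₀ := sub_pos.2 hs₀.2
  have ht0 : (0 : ℝ) < t₀ := ht₀.1
  have ht1 : (0 : ℝ) < 1 - t₀ := sub_pos.2 ht₀.2
  -- The radius is also below the distance to the sides of the square, so that the clamps are
  -- inactive.
  obtain ⟨r, hw, hsm, hr⟩ := (hev.and (hsmall.and (Ioo_mem_nhdsGT
    (lt_min (lt_min hs0 hs1) (lt_min ht0 ht1))))).exists
  refine ⟨r, hr.1, ?_⟩
  obtain ⟨⟨hrs0, hrs1⟩, hrt0, hrt1⟩ : (r < s₀ ∧ r < 1 - s₀) ∧ r < t₀ ∧ r < 1 - t₀ := by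
    simpa [lt_min_iff] using hr.2
  set W : ℝ → Fin 2 → ℝ := fun u =>
    c' (s₀ + r * Real.cos (2 * Real.pi * u)) - d' (t₀ - r * Real.sin (2 * Real.pi * u)) with hW
  have hWc : Continuous W := by fun_prop
  have hW1 : W 0 = W 1 := by simp [hW]
  have hΘ : HasWindingNumber (fun u => latticeTheta (W u)) 1 := by
    refine hw.of_re_mul_conj_pos (continuous_planePoint.comp hWc).continuousOn
      (continuous_latticeTheta.comp hWc).continuousOn (congrArg planePoint hW1)
      (congrArg latticeTheta hW1) fun u hu => latticeTheta_mul_conj_pos (fun h0 => ?_)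
        ((norm_le_pi_norm (W u) 0).trans (hsm u)) ((norm_le_pi_norm (W u) 1).trans (hsm u))
    obtain ⟨L, -, hexp, -⟩ := hw
    refine Complex.exp_ne_zero (L u) ((hexp u hu).trans ?_)
    change planePoint (W u) = 0
    rw [h0]
    rfl
  -- compare with the other lifts
  obtain ⟨m, hm⟩ : ∃ m : Fin 2 → ℤ, ∀ s t : unitInterval,
      γ s - κ t = (c' s - d' t) + fun i => (m i : ℝ) := by
    obtain ⟨m₁, hm₁⟩ := mem_latticeOf_one.1
      (proj_eq_proj_iff.1 ((hc'p s₀).trans (hγp s₀).symm))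
    obtain ⟨m₂, hm₂⟩ := mem_latticeOf_one.1
      (proj_eq_proj_iff.1 ((hd'p t₀).trans (hκp t₀).symm))
    refine ⟨m₁ - m₂, fun s t => ?_⟩
    have h1 := sub_eq_sub_of_proj_eq hdet (f := fun s : unitInterval => c' s) (by fun_prop) hγ
      (fun s => (hc'p s).trans (hγp s).symm) s s₀
    have h2 := sub_eq_sub_of_proj_eq hdet (f := fun t : unitInterval => d' t) (by fun_prop) hκ
      (fun t => (hd'p t).trans (hκp t).symm) t t₀
    rw [hm₁] at h1
    rw [hm₂] at h2
    ext i
    have h1 := congrFun h1 i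
    have h2 := congrFun h2 i
    simp only [Pi.sub_apply, Pi.add_apply, Int.cast_sub] at h1 h2 ⊢
    linarith
  refine hΘ.exp_mul (ℓ := fun u => -(2 * Real.pi * Complex.I * m 1 * (W u 0 + 1 / 2 : ℝ)))
    (by fun_prop) (by simp only [hW1]) fun u _ => ?_
  have hin : ∀ x y : ℝ, |x| ≤ 1 → r < y → r < 1 - y → y + r * x ∈ Icc (0 : ℝ) 1 := by
    intro x y hx h1 h2
    obtain ⟨h3, h4⟩ := abs_le.1 hx
    constructor <;> nlinarith [hr.1]
  have hin1 := hin _ _ (Real.abs_cos_le_one (2 * Real.pi * u)) hrs0 hrs1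
  have hin2 := hin (-Real.sin (2 * Real.pi * u)) _
    (by rw [abs_neg]; exact Real.abs_sin_le_one _) hrt0 hrt1
  rw [mul_neg, ← sub_eq_add_neg] at hin2
  rw [hm, projIcc_of_mem _ hin1, projIcc_of_mem _ hin2]
  exact latticeTheta_add (W u) m

section Dual

variable {V E F : Type*} {G : Multigraph V E} {G' : Multigraph F E}
  {Γ : Drawing G (FlatTorus 1)} {K : Drawing G' (FlatTorus 1)}

/-- Up to coboundaries in both graphs, the intersection number of an edge and a dual edge is the
determinant of their integer displacement vectors. -/
theorem IsNaturalDual.exists_intersection_eq [DecidableEq E] (hK : IsNaturalDual Γ K)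
    {p : V → Fin 2 → ℝ} {γ : E → unitInterval → Fin 2 → ℝ} {b : E → Fin 2 → ℤ}
    (hγ : Γ.IsLift p γ b)
    {q : F → Fin 2 → ℝ} {κ : E → unitInterval → Fin 2 → ℝ} {a : E → Fin 2 → ℤ}
    (hκ : K.IsLift q κ a) :
    ∃ (Φ : E → F → ℝ) (Ψ : E → V → ℝ), ∀ e e', (if e = e' then 1 else 0 : ℝ) =
      (b e 0 * a e' 1 - b e 1 * a e' 0) + (Φ e (G'.head e') - Φ e (G'.tail e'))
        + (Ψ e' (G.head e) - Ψ e' (G.tail e)) := by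
  -- The change along `e` seen from a dual vertex depends only on that pair, which is why
  -- differences of it form a coboundary. The default 0 never enters: only endpoints of dual edges
  -- are used below, and `e` avoids them.
  have hA : ∀ e x, ∃ c, (∀ s, Γ.edge e s ≠ K.vert x) →
      HasLogChange (fun s => latticeTheta (γ e s - q x)) c := by
    intro e x
    by_cases h : ∀ s, Γ.edge e s ≠ K.vert x
    · obtain ⟨c, hc⟩ := exists_hasLogChange (φ := fun s => latticeTheta (γ e s - q x))
        (continuous_latticeTheta.comp ((hγ.continuous e).sub continuous_const)) fun s hs => h s (by
          rw [← hγ.proj_edge, ← hκ.proj_vert, eq_comm, proj_eq_proj_iff, mem_latticeOf_one]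
          exact latticeTheta_eq_zero hs)
      exact ⟨c, fun _ => hc⟩
    · exact ⟨0, fun h' => absurd h' h⟩
  have hB : ∀ e v, ∃ c, (∀ t, Γ.vert v ≠ K.edge e t) →
      HasLogChange (fun t => latticeTheta (p v - κ e t)) c := by
    intro e v
    by_cases h : ∀ t, Γ.vert v ≠ K.edge e t
    · obtain ⟨c, hc⟩ := exists_hasLogChange (φ := fun t => latticeTheta (p v - κ e t))
        (continuous_latticeTheta.comp (continuous_const.sub (hκ.continuous e))) fun s hs => h s (by
          rw [← hγ.proj_vert, ← hκ.proj_edge, eq_comm, proj_eq_proj_iff, mem_latticeOf_one]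
          exact latticeTheta_eq_zero hs)
      exact ⟨c, fun _ => hc⟩
    · exact ⟨0, fun h' => absurd h' h⟩
  choose A hA using hA
  choose B hB using hB
  -- The terms `b e 1 * q x 0` and `a e 1 * p v 0` are the parts of the quasi-periodicity exponents
  -- on the sides `t = 1` and `s = 1` that come from the lifted vertices; what is left of the
  -- exponents is the determinant.
  refine ⟨fun e x => (A e x / (2 * Real.pi * Complex.I)).re - b e 1 * q x 0,
    fun e v => a e 1 * p v 0 - (B e v / (2 * Real.pi * Complex.I)).re, fun e e' => ?_⟩
  have hmeet : ∀ s t, Γ.edge e s = K.edge e' t →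
      e = e' ∧ s ∈ Ioo (0 : unitInterval) 1 ∧ t ∈ Ioo (0 : unitInterval) 1 := by
    intro s t hst
    obtain rfl := hK.crosses_only e e' s t hst
    obtain ⟨s₀, hs₀, t₀, ht₀, h, -⟩ := hK.crosses e
    obtain ⟨rfl, rfl⟩ := (h s t).1 hst
    exact ⟨rfl, hs₀, ht₀⟩
  have h0 : (0 : unitInterval) ∉ Ioo (0 : unitInterval) 1 := fun h => lt_irrefl _ h.1
  have h1 : (1 : unitInterval) ∉ Ioo (0 : unitInterval) 1 := fun h => lt_irrefl _ h.2
  have hAt := hA e (G'.tail e') fun s h =>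
    h0 (hmeet s 0 (h.trans (K.edge_zero e').symm)).2.2
  have hAh := hA e (G'.head e') fun s h =>
    h1 (hmeet s 1 (h.trans (K.edge_one e').symm)).2.2
  have hBt := hB e' (G.tail e) fun t h =>
    h0 (hmeet 0 t ((Γ.edge_zero e).trans h)).2.1
  have hBh := hB e' (G.head e) fun t h =>
    h1 (hmeet 1 t ((Γ.edge_one e).trans h)).2.1
  set g : unitInterval × unitInterval → ℂ := fun z => latticeTheta (γ e z.1 - κ e' z.2) with hg
  have hgc : Continuous g := by
    have h1 := hγ.continuous e
    have h2 := hκ.continuous e'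
    exact continuous_latticeTheta.comp (by fun_prop)
  have hg0 : ∀ s t, g (s, t) = 0 → Γ.edge e s = K.edge e' t := fun s t h => by
    rw [← hγ.proj_edge, ← hκ.proj_edge, eq_comm, proj_eq_proj_iff, mem_latticeOf_one]
    exact latticeTheta_eq_zero h
  have hc₀ : HasLogChange (fun s => g (s, 0)) (A e (G'.tail e')) :=
    hAt.congr (fun s => by rw [hg]; simp only [hκ.zero]) rfl
  have hd₀ : HasLogChange (fun t => g (0, t)) (B e' (G.tail e)) :=
    hBt.congr (fun t => by rw [hg]; simp only [hγ.zero]) rfl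
  -- The lift `κ e' 1` is the lifted head plus `a e'`, so the argument is translated by `-a e'`; the
  -- exponent varies with `γ e s`.
  have hc₁ : HasLogChange (fun s => g (s, 1)) (2 * Real.pi * Complex.I * a e' 1 *
      ((p (G.head e) 0 + b e 0 - p (G.tail e) 0 : ℝ)) + A e (G'.head e')) := by
    have hcont := hγ.continuous e
    refine ((HasLogChange.exp (ℓ := fun s => -(2 * Real.pi * Complex.I * (-a e' 1 : ℤ) *
      ((γ e s - q (G'.head e')) 0 + 1 / 2 : ℝ))) (by fun_prop)).mul hAh).congr (fun s => ?_) ?_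
    · have := latticeTheta_add (γ e s - q (G'.head e')) (-a e')
      rw [Pi.neg_apply] at this
      rw [← this, hg]
      simp only [hκ.one]
      congr 1
      ext i
      simp
      ring
    · simp only [hγ.one, hγ.zero, Pi.sub_apply, Pi.add_apply]
      push_cast
      ring
  have hd₁ : HasLogChange (fun t => g (1, t)) (2 * Real.pi * Complex.I * b e 1 *
      ((q (G'.head e') 0 + a e' 0 - q (G'.tail e') 0 : ℝ)) + B e' (G.head e)) := by
    have hcont := hκ.continuous e'
    refine ((HasLogChange.exp (ℓ := fun t => -(2 * Real.pi * Complex.I * (b e 1) *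
      ((p (G.head e) - κ e' t) 0 + 1 / 2 : ℝ))) (by fun_prop)).mul hBh).congr (fun t => ?_) ?_
    · rw [← latticeTheta_add (p (G.head e) - κ e' t) (b e), hg]
      simp only [hγ.one]
      congr 1
      ext i
      simp
      ring
    · simp only [hκ.one, hκ.zero, Pi.sub_apply, Pi.add_apply]
      push_cast
      ring
  have hsum : (2 * Real.pi * Complex.I * a e' 1 *
      ((p (G.head e) 0 + b e 0 - p (G.tail e) 0 : ℝ)) + A e (G'.head e'))
      - (2 * Real.pi * Complex.I * b e 1 *
      ((q (G'.head e') 0 + a e' 0 - q (G'.tail e') 0 : ℝ)) + B e' (G.head e))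
      - A e (G'.tail e') + B e' (G.tail e)
      = (if e = e' then 1 else 0 : ℝ) * (2 * Real.pi * Complex.I) := by
    by_cases hee : e = e'
    · subst hee
      obtain ⟨s₀, hs₀, t₀, ht₀, hcd, r, hr, hw⟩ := (hK.crosses e).exists_hasWindingNumber
        (hγ.continuous e) (hκ.continuous e) (hγ.proj_edge e) (hκ.proj_edge e)
      simpa using boundary_logChange_eq hgc hs₀ ht₀ (fun s t h => (hcd s t).1 (hg0 s t h)) hr hw
        hc₀ hc₁ hd₀ hd₁
    · simpa [hee] using boundary_logChange_eq_zero hgc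
        (fun z h => hee (hmeet _ _ (hg0 z.1 z.2 h)).1) hc₀ hc₁ hd₀ hd₁
  have hdiv : ((if e = e' then 1 else 0 : ℝ) : ℂ) =
      ((a e' 1 * (p (G.head e) 0 + b e 0 - p (G.tail e) 0)
        - b e 1 * (q (G'.head e') 0 + a e' 0 - q (G'.tail e') 0) : ℝ) : ℂ)
      + A e (G'.head e') / (2 * Real.pi * Complex.I)
      - A e (G'.tail e') / (2 * Real.pi * Complex.I)
      - B e' (G.head e) / (2 * Real.pi * Complex.I)
      + B e' (G.tail e) / (2 * Real.pi * Complex.I) := by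
    have h2 := Complex.two_pi_I_ne_zero
    rw [eq_div_of_mul_eq h2 hsum.symm]
    field_simp
    push_cast
    ring
  have hre := congrArg Complex.re hdiv
  simp only [Complex.add_re, Complex.sub_re, Complex.ofReal_re] at hre
  rw [hre]
  ring

end Dual

/-! ### Force diagrams -/

/-- An equilibrium stress is orthogonal to coboundaries. -/
theorem IsEquilibriumStress.sum_mul_sub_eq_zero {V E : Type*} [Finite V] [Fintype E]
    {G : Multigraph V E} {D : Matrix (Fin 2) E ℝ} {ω : E → ℝ} (h : IsEquilibriumStress G D ω)
    (ψ : V → ℝ) (i : Fin 2) : ∑ e, D i e * ω e * (ψ (G.head e) - ψ (G.tail e)) = 0 := by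
  classical
  cases nonempty_fintype V
  have hp : ∀ v, (∑ e with G.head e = v, D i e * ω e * ψ (G.head e))
      - ∑ e with G.tail e = v, D i e * ω e * ψ (G.tail e) = 0 := fun v => by
    have h1 := congrFun (h v) i
    simp only [Pi.add_apply, Finset.sum_apply, Pi.smul_apply, Pi.neg_apply, smul_eq_mul, mul_neg,
      Finset.sum_neg_distrib, Pi.zero_apply] at h1
    have h2 : ∀ f : E → V, ∑ e with f e = v, D i e * ω e * ψ (f e)
        = (∑ e with f e = v, ω e * D i e) * ψ v := fun f => by
      rw [Finset.sum_mul]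
      refine Finset.sum_congr rfl fun e he => ?_
      rw [(Finset.mem_filter.1 he).2]
      ring
    rw [h2, h2]
    have h1' : (∑ e with G.tail e = v, ω e * D i e) = ∑ e with G.head e = v, ω e * D i e := by
      rwa [← sub_eq_add_neg, sub_eq_zero] at h1
    rw [h1', sub_self]
  simp only [mul_sub, Finset.sum_sub_distrib]
  rw [← Finset.sum_fiberwise Finset.univ G.head, ← Finset.sum_fiberwise Finset.univ G.tail,
    ← Finset.sum_sub_distrib]
  exact Finset.sum_eq_zero fun v _ => hp v

/-- A system of displacement vectors that differs by a coboundary from the image under `N` of the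
integer displacements of a lift of `K` is realized by a geodesic drawing homotopic to `K`. -/
theorem Drawing.IsLift.exists_isGeodesicWith {F E : Type*} {G' : Multigraph F E}
    {K : Drawing G' (FlatTorus 1)} {q : F → Fin 2 → ℝ} {κ : E → unitInterval → Fin 2 → ℝ}
    {a : E → Fin 2 → ℤ} (hκ : K.IsLift q κ a) {N : Matrix (Fin 2) (Fin 2) ℝ}
    {D : Matrix (Fin 2) E ℝ} {h : F → Fin 2 → ℝ}
    (hD : ∀ e i, D i e = (N *ᵥ fun j => (a e j : ℝ)) i + (h (G'.head e) i - h (G'.tail e) i)) :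
    ∃ H : Drawing G' (FlatTorus N), H.IsGeodesicWith D ∧ H.Homotopic (K.map (ofSquare N)) := by
  have hc : ∀ e, Continuous fun z : unitInterval × unitInterval =>
      proj N ((1 - z.1 : ℝ) • (h (G'.tail e) + (z.2 : ℝ) • fun i => D i e)
        + (z.1 : ℝ) • N *ᵥ κ e z.2) := fun e => by
    have := hκ.continuous e
    exact continuous_proj.comp (by fun_prop)
  -- Straight-line homotopy in the plane from the segments starting at `h` to the image under `N` of
  -- the lift. The far end of an edge is off its head by the same lattice vector `N a` at all times,
  -- so it closes up on the quotient even if `N` is singular.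
  let P : unitInterval → Drawing G' (FlatTorus N) := fun u =>
    { vert := fun v => proj N ((1 - u : ℝ) • h v + (u : ℝ) • N *ᵥ q v)
      edge := fun e => ⟨_, (hc e).comp (by fun_prop : Continuous fun t => (u, t))⟩
      edge_zero := fun e => by simp [hκ.zero]
      edge_one := fun e => by
        refine (proj_eq_proj_iff.2 ⟨a e, ?_⟩).symm
        have hDe : (fun i => D i e) = (N *ᵥ fun j => (a e j : ℝ))
            + (h (G'.head e) - h (G'.tail e)) := funext fun i => hD e i
        simp only [hDe, hκ.one, mulVec_add, Set.Icc.coe_one]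
        module }
  refine ⟨P 0, fun e => ⟨h (G'.tail e), fun t => ?_⟩, P, rfl, ?_, fun v => ?_, hc⟩
  · refine congrArg (proj N) ?_
    simp only [Set.Icc.coe_zero, sub_zero, one_smul, zero_smul, add_zero]
  · ext1
    · ext v
      rw [show (K.map (ofSquare N)).vert v = ofSquare N (proj 1 (q v)) by
        rw [hκ.proj_vert]; rfl]
      change proj N _ = proj N (N *ᵥ q v)
      simp
    · ext e t
      rw [show (K.map (ofSquare N)).edge e t = ofSquare N (proj 1 (κ e t)) by
        rw [hκ.proj_edge]; rfl]
      change proj N _ = proj N (N *ᵥ κ e t)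
      simp
  · exact continuous_proj.comp (by fun_prop)

theorem lemmaL {V E F : Type*} [Finite V] [Fintype E] [DecidableEq E]
    (G : Multigraph V E) (G' : Multigraph F E)
    (M : Matrix (Fin 2) (Fin 2) ℝ) (hM : M.det ≠ 0)
    -- a geodesic drawing of `G` on the flat torus of `M`, with reference displacement matrix `Δ`
    (Γ : Drawing G (FlatTorus M)) (Δ : Matrix (Fin 2) E ℝ) (hΔ : Γ.IsGeodesicWith (M * Δ))
    -- homotopic to (the image of) an embedding, with dual graph `G'`
    (Γ₀ : Drawing G (FlatTorus 1)) (hΓ₀ : Γ₀.IsEmbedding)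
    (hΓ : Γ.Homotopic (Γ₀.map (FlatTorus.ofSquare M)))
    (K : Drawing G' (FlatTorus 1)) (hK : IsNaturalDual Γ₀ K)
    -- an arbitrary equilibrium stress
    (ω : E → ℝ) (hω : IsEquilibriumStress G (M * Δ) ω)
    (N : Matrix (Fin 2) (Fin 2) ℝ)
    (hN : N = quarterTurn * M * Δ * Matrix.diagonal ω * Δᵀ * quarterTurnᵀ) :
    ∃ H : Drawing G' (FlatTorus N), IsOrthogonalForceDiagram H K (M * Δ) ω := by
  obtain ⟨p, γ, b, hγ⟩ := Γ₀.exists_isLift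
  obtain ⟨q, κ, a, hκ⟩ := K.exists_isLift
  obtain ⟨x, hx⟩ := hΔ.exists_eq_add_sub hM hΓ hγ
  obtain ⟨Φ, Ψ, hint⟩ := hK.exists_intersection_eq hγ hκ
  set D := M * Δ with hD
  have hX : ∀ (ψ : V → ℝ) (i : Fin 2),
      ∑ e, (quarterTurn * D) i e * ω e * (ψ (G.head e) - ψ (G.tail e)) = 0 := by
    intro ψ i
    simp only [Matrix.mul_apply, Finset.sum_mul]
    rw [Finset.sum_comm]
    refine Finset.sum_eq_zero fun j _ => ?_
    simp only [mul_assoc]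
    rw [← Finset.mul_sum]
    simp only [← mul_assoc]
    rw [hω.sum_mul_sub_eq_zero ψ j, mul_zero]
  obtain ⟨H, hgeo, hhom⟩ := hκ.exists_isGeodesicWith (N := N)
    (D := quarterTurn * D * Matrix.diagonal ω)
    -- The potential collects the dual coboundaries `Φ e`, weighted by the rotated forces.
    (h := fun v i => ∑ e, (quarterTurn * D) i e * ω e * Φ e v) (fun e' i => by
      -- The entries of $\Delta^T J^T a$ are the determinants $\det(\Delta_e, a)$.
      have hNa : (N *ᵥ fun j => (a e' j : ℝ)) i = ∑ e, (quarterTurn * D) i e * ω e *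
          (Δ 0 e * a e' 1 - Δ 1 e * a e' 0) := by
        have hN' : N = (quarterTurn * D * Matrix.diagonal ω) * (Δᵀ * quarterTurnᵀ) := by
          rw [hN, hD]
          simp only [Matrix.mul_assoc]
        rw [hN', ← mulVec_mulVec, Matrix.mulVec, dotProduct]
        refine Finset.sum_congr rfl fun e _ => ?_
        rw [mul_diagonal]
        congr 1
        simp [Matrix.mulVec, dotProduct, Matrix.mul_apply, quarterTurn]
        ring
      have hsplit : (quarterTurn * D * Matrix.diagonal ω) i e' =
          ∑ e, (quarterTurn * D) i e * ω e * (if e = e' then 1 else 0) := by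
        simp [mul_diagonal]
      -- Both coboundaries of `G` vanish together: the one from replacing `b` by `Δ` inside the
      -- determinant, and `Ψ e'`.
      have hcob := hX (fun v => x v 0 * a e' 1 - x v 1 * a e' 0 + Ψ e' v) i
      refine sub_eq_zero.1 (Eq.trans ?_ hcob)
      rw [hsplit, hNa, ← Finset.sum_sub_distrib, ← Finset.sum_add_distrib,
        ← Finset.sum_sub_distrib]
      refine Finset.sum_congr rfl fun e _ => ?_
      rw [hint, hx, hx]
      ring)
  exact ⟨H, hhom, hgeo⟩
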